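/- Let $v\colon \mathbb{R}\times X\to X$ be a flow on a compact metrizable space $X$, with orbits $O(x)=\{v(t,x)\mid t\in\mathbb{R}\}$, and let $\mathcal{F}_v$ be the decomposition of $X$ into orbits, regarded also as the semi-decomposition $x\mapsto \mathcal{F}_v(x)=O(x)$. Fix a metric $d$ inducing the topology of $X$. The chain recurrent set $CR(v)$ is the set of points $x$ such that for all $\varepsilon>0$ and $T>0$ there are $k\ge 1$, points $x=x_0,x_1,\dots,x_k=x$ and times $t_0,\dots,t_{k-1}\ge T$ with $d(v(t_i,x_i),x_{i+1})<\varepsilon$ for all $i<k$. Let $\mathcal{X}$ be the set of connected components of $CR(v)$. For $I\subseteq\mathcal{X}$, let $H_I$ be the set of points $x\in X\setminus\bigsqcup\mathcal{X}$ for which there are pairwise disjoint non-empty sets $C_i\subseteq i$ $(i\in I)$ with $\overline{O(x)}\setminus O(x)=\bigsqcup_{i\in I}C_i$. Let $\mathcal{G}_{\mathcal{X}}$ be the pair with vertex set $V=\mathcal{X}$ and set of hyper-edges $H=\{I\subseteq\mathcal{X}\mid H_I\neq\emptyset\}$. It is called a Morse hyper-graph of $\mathcal{X}$ with respect to $\mathcal{F}_v$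 if the members of $\mathcal{X}$ are pairwise disjoint, every $I \in H$ is finite and non-empty, and $X\setminus\bigsqcup\mathcal{X}=\bigsqcup_{I\subseteq\mathcal{X}}H_I$ (a disjoint union). The Morse graph $G_v$ of $v$ is the directed graph with vertex set $\mathcal{X}$ in which $(M,N)$ is an edge if and only if there is a point $x\in X\setminus CR(v)$ with $\alpha(x)\subseteq M$ and $\omega(x)\subseteq N$, where $\alpha(x)$ and $\omega(x)$ are the $\alpha$- and $\omega$-limit sets of $x$. Then $\mathcal{G}_{\mathcal{X}}$ is a Morse hyper-graph of $\mathcal{X}$ with respect to $\mathcal{F}_v$, and it is the Morse graph $G_v$ viewed as an undirected graph: its hyper-edges are exactly the sets $\{M,N\}$ for which $(M,N)$ is an edge of $G_v$. Moreover, $G_v$ has no loops, and $(M,N)$ and $(N,M)$ are never both edges of $G_v$, so that each hyper-edge of $\mathcal{G}_{\mathcal{X}}$ comes from exactly one directed edge. -/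

import Mathlib

open Set Filter Topology

/-- A semi-decomposition of a set `X`: a map `F : X → 2^X` with `x ∈ F x`, and
`F x ⊆ F y` whenever `x ∈ F y`. -/
structure SemiDecomposition (X : Type*) where
  /-- the element of the point `x` -/
  elem : X → Set X
  mem_elem : ∀ x, x ∈ elem x
  elem_subset : ∀ x y, x ∈ elem y → elem x ⊆ elem y

namespace SemiDecomposition

/-- A decomposition (a family `D` of pairwise disjoint non-empty subsets covering `X`) regarded as
a semi-decomposition: a point `x` is sent to the element of `D` that contains it. -/
def ofDecomposition {X : Type*} (D : Set (Set X)) (hD : Setoid.IsPartition D) :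
    SemiDecomposition X where
  elem x := ⋃₀ {L | L ∈ D ∧ x ∈ L}
  mem_elem x := by
    obtain ⟨L, ⟨hL, hx⟩, -⟩ := hD.2 x
    exact ⟨L, ⟨hL, hx⟩, hx⟩
  elem_subset x y := by
    rintro ⟨L, ⟨hL, hy⟩, hx⟩ z ⟨L', ⟨hL', hx'⟩, hz⟩
    obtain rfl : L' = L := (hD.2 x).unique ⟨hL', hx'⟩ ⟨hL, hx⟩
    exact ⟨L', ⟨hL, hy⟩, hz⟩

variable {X : Type*} [TopologicalSpace X]

/-- The derived set of the element of `x`: the closure of the element minus the element. -/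
def derivedElem (F : SemiDecomposition X) (x : X) : Set X :=
  closure (F.elem x) \ F.elem x

/-- The set `H_I` for a subfamily `I` of `𝒳`: the points `x` outside the union of `𝒳` for which
the derived set of the element of `x` is a disjoint union of non-empty sets `C i ⊆ i`, `i ∈ I`. -/
def hyperEdge (F : SemiDecomposition X) (𝒳 : Set (Set X)) (I : Set (Set X)) : Set X :=
  {x | x ∉ ⋃₀ 𝒳 ∧ ∃ C : Set X → Set X,
    (∀ i ∈ I, (C i).Nonempty ∧ C i ⊆ i) ∧ I.PairwiseDisjoint C ∧
      F.derivedElem x = ⋃ i ∈ I, C i}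

/-- The pair `(V, H)` with `V = 𝒳` and `H` the set of all `I ⊆ 𝒳` such that `H_I ≠ ∅`. -/
def morseHypergraph (F : SemiDecomposition X) (𝒳 : Set (Set X)) : Hypergraph (Set X) where
  vertexSet := 𝒳
  edgeSet := {I | I ⊆ 𝒳 ∧ (F.hyperEdge 𝒳 I).Nonempty}
  subset_vertexSet_of_mem_edgeSet' := fun _ h => h.1

/-- The condition that the pair `F.morseHypergraph 𝒳` is a Morse hyper-graph of `𝒳`: the members
of `𝒳` are pairwise disjoint, the edges are non-empty finite sets of vertices, and the complement
of the union of `𝒳` is the disjoint union of the sets `H_I`, `I ⊆ 𝒳`. -/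
structure IsMorseHypergraph (F : SemiDecomposition X) (𝒳 : Set (Set X)) : Prop where
  pairwiseDisjoint : 𝒳.PairwiseDisjoint id
  edge_finite : ∀ e ∈ (F.morseHypergraph 𝒳).edgeSet, e.Finite ∧ e.Nonempty
  compl_eq : (⋃₀ 𝒳)ᶜ = ⋃ I ∈ 𝒳.powerset, F.hyperEdge 𝒳 I
  hyperEdge_disjoint : 𝒳.powerset.PairwiseDisjoint (F.hyperEdge 𝒳)

end SemiDecomposition

/-- A directed graph with vertex set `S`, regarded as an undirected graph, i.e. as a hyper-graph
whose edges are the sets `{a, b}` for the directed edges `(a, b)`. -/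
def Digraph.toUndirected {α : Type*} {S : Set α} (G : Digraph S) : Hypergraph α where
  vertexSet := S
  edgeSet := {e | ∃ a b : S, G.Adj a b ∧ e = {(a : α), (b : α)}}
  subset_vertexSet_of_mem_edgeSet' := by
    rintro _ ⟨a, b, -, rfl⟩ x (rfl | rfl)
    exacts [a.2, b.2]

namespace Flow

/-- The set of orbits of a flow. -/
def orbits {X : Type*} [TopologicalSpace X] (v : Flow ℝ X) : Set (Set X) :=
  range v.orbit

theorem orbit_eq_of_mem {X : Type*} [TopologicalSpace X] (v : Flow ℝ X) {x y : X}
    (h : y ∈ v.orbit x) : v.orbit y = v.orbit x := by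
  obtain ⟨t, rfl⟩ := v.mem_orbit_iff.1 h
  ext z
  rw [v.mem_orbit_iff, v.mem_orbit_iff]
  constructor
  · rintro ⟨s, rfl⟩
    exact ⟨s + t, v.map_add s t x⟩
  · rintro ⟨s, rfl⟩
    exact ⟨s - t, by rw [← v.map_add, sub_add_cancel]⟩

/-- The orbits of a flow form a decomposition of the space. -/
theorem isPartition_orbits {X : Type*} [TopologicalSpace X] (v : Flow ℝ X) :
    Setoid.IsPartition v.orbits := by
  refine ⟨?_, fun x => ⟨v.orbit x, ⟨⟨x, rfl⟩, v.mem_orbit_self x⟩, ?_⟩⟩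
  · rintro ⟨x, hx⟩
    exact (v.nonempty_orbit x).ne_empty hx
  · rintro _ ⟨⟨y, rfl⟩, hy⟩
    exact (v.orbit_eq_of_mem hy).symm

/-- The (semi-)decomposition of the space into the orbits of a flow. -/
def orbitDecomposition {X : Type*} [TopologicalSpace X] (v : Flow ℝ X) : SemiDecomposition X :=
  SemiDecomposition.ofDecomposition v.orbits v.isPartition_orbits

theorem orbitDecomposition_elem {X : Type*} [TopologicalSpace X] (v : Flow ℝ X) (x : X) :
    v.orbitDecomposition.elem x = v.orbit x := by
  ext z
  constructor
  · rintro ⟨_, ⟨⟨y, rfl⟩, hx⟩, hz⟩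
    rwa [v.orbit_eq_of_mem hx]
  · exact fun hz => ⟨v.orbit x, ⟨⟨x, rfl⟩, v.mem_orbit_self x⟩, hz⟩

/-- There is an `(ε, T)`-chain from `x` to `y`: points `x = x₀, …, xₖ = y` with `k ≥ 1` and times
`tᵢ ≥ T` such that `dist (v tᵢ xᵢ) xᵢ₊₁ < ε` for all `i < k`. -/
def HasChain {X : Type*} [MetricSpace X] (v : Flow ℝ X) (ε T : ℝ) (x y : X) : Prop :=
  Relation.TransGen (fun a b : X => ∃ t : ℝ, T ≤ t ∧ dist (v t a) b < ε) x y

/-- The chain recurrent set of a flow. -/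
def chainRecurrentSet {X : Type*} [MetricSpace X] (v : Flow ℝ X) : Set X :=
  {x | ∀ ε > 0, ∀ T > 0, v.HasChain ε T x x}

/-- The set of connected components of the chain recurrent set. -/
def chainComponents {X : Type*} [MetricSpace X] (v : Flow ℝ X) : Set (Set X) :=
  {M | ∃ x ∈ v.chainRecurrentSet, M = connectedComponentIn v.chainRecurrentSet x}

/-- The Morse graph of a flow: the vertices are the connected components of the chain recurrent
set, and `(M, N)` is a directed edge if there is a point outside the chain recurrent set whose
`α`-limit set is contained in `M` and whose `ω`-limit set is contained in `N`. -/
def morseGraph {X : Type*} [MetricSpace X] (v : Flow ℝ X) : Digraph v.chainComponents where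
  Adj M N := ∃ x ∉ v.chainRecurrentSet,
    omegaLimit atBot v {x} ⊆ (M : Set X) ∧ omegaLimit atTop v {x} ⊆ (N : Set X)

end Flow

/-!
Write `x ⇝ y` if for all `ε, T > 0` there is an `(ε, T)`-chain from `x` to `y`; this relation is
transitive, and the chain recurrent set `CR` consists of the points with `x ⇝ x`. The following
facts give the theorem.

* The closure of an orbit `O(x)` is `O(x) ∪ α(x) ∪ ω(x)`, both limit sets are contained in `CR`
  (`Flow.omegaLimit_atTop_subset_chainRecurrentSet`,
  `Flow.omegaLimit_atBot_subset_chainRecurrentSet`), and `CR` is invariant. So for `x ∉ CR` the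
  derived set of `O(x)` is exactly `α(x) ∪ ω(x)` (`Flow.derivedElem_orbitDecomposition`).
* Limit sets are non-empty and connected, so each of the two lies in a single component of `CR`.
* Points `a`, `b` of the same component of `CR` satisfy `a ⇝ b`
  (`Flow.chainRelated_of_isPreconnected`): an `(ε, T)`-chain from a point to itself survives small
  changes of one of its ends, so nearby points of the component are joined by chains in both
  directions, and connectedness extends this to the whole component.
* If `z ∈ ω(x)`, then `x ⇝ z`, and if `z ∈ α(x)`, then `z ⇝ x`. Hence an edge of the Morse graph
  from `M` to `N`, given by a point `x`, yields `a ⇝ x ⇝ b` for all `a ∈ M` and `b ∈ N`. A loop or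
  a pair of opposite edges would close up to `x ⇝ x`, although `x ∉ CR`.

Therefore the derived set of the orbit of `x ∉ CR` meets exactly two components `M ≠ N`. Since a
set covered by pairwise disjoint sets is a disjoint union of non-empty pieces of exactly those of
them which it meets (`SemiDecomposition.mem_hyperEdge_iff`), `x` lies in `H_I` for `I = {M, N}` and
for no other `I`.
-/

/-! ### Derived sets and hyper-edges -/

/-- A point outside the union of a disjoint family `𝒳` lies in `H_I` exactly when its derived set
is covered by `𝒳` and `I` consists of the members of `𝒳` that it meets. -/
theorem SemiDecomposition.mem_hyperEdge_iff {X : Type*} [TopologicalSpace X]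
    (F : SemiDecomposition X) {𝒳 I : Set (Set X)} (h𝒳 : 𝒳.PairwiseDisjoint id) (hI : I ⊆ 𝒳)
    {x : X} :
    x ∈ F.hyperEdge 𝒳 I ↔
      x ∉ ⋃₀ 𝒳 ∧ F.derivedElem x ⊆ ⋃₀ 𝒳 ∧ I = {i ∈ 𝒳 | (F.derivedElem x ∩ i).Nonempty} := by
  refine and_congr_right fun _ => ⟨?_, ?_⟩
  · rintro ⟨C, hC, -, hD⟩
    refine ⟨?_, Subset.antisymm (fun i hi => ⟨hI hi, ?_⟩) ?_⟩
    · rw [hD]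
      exact iUnion₂_subset fun i hi => (hC i hi).2.trans (subset_sUnion_of_mem (hI hi))
    · obtain ⟨y, hy⟩ := (hC i hi).1
      exact ⟨y, hD ▸ mem_biUnion hi hy, (hC i hi).2 hy⟩
    · rintro i ⟨hi, y, hyD, hyi⟩
      rw [hD] at hyD
      obtain ⟨j, hj, hyj⟩ := mem_iUnion₂.1 hyD
      rwa [h𝒳.elim_set hi (hI hj) y hyi ((hC j hj).2 hyj)]
  · rintro ⟨hD, rfl⟩
    refine ⟨fun i => F.derivedElem x ∩ i, fun i hi => ⟨hi.2, inter_subset_right⟩, ?_, ?_⟩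
    · exact fun i hi j hj hij =>
        (h𝒳 hi.1 hj.1 hij).mono inter_subset_right inter_subset_right
    · refine Subset.antisymm (fun y hy => ?_) (iUnion₂_subset fun i _ => inter_subset_left)
      obtain ⟨i, hi, hyi⟩ := hD hy
      exact mem_biUnion (show i ∈ {i ∈ 𝒳 | (F.derivedElem x ∩ i).Nonempty} from
        ⟨hi, y, hy, hyi⟩) ⟨hy, hyi⟩

namespace Flow

/-! ### Limit sets -/

section LimitSets

variable {X : Type*} [TopologicalSpace X] (v : Flow ℝ X)

/-- Along a filter with a basis of connected sets of times, the limit set of a point of a compact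
space is connected: disjoint neighbourhoods of two closed pieces of it would separate the orbit
at such a set of times. -/
theorem isPreconnected_omegaLimit [T2Space X] [CompactSpace X] {f : Filter ℝ}
    (hf : ∀ u ∈ f, ∃ s ∈ f, s ⊆ u ∧ IsPreconnected s) (x : X) :
    IsPreconnected (omegaLimit f v {x}) := by
  rw [isPreconnected_iff_subset_of_fully_disjoint_closed (isClosed_omegaLimit f v {x})]
  intro A B hA hB hAB hdisj
  obtain ⟨U, V, hU, hV, hAU, hBV, hUV⟩ := normal_separation hA hB hdisj
  have hev := eventually_mapsTo_of_isOpen_of_omegaLimit_subset f v {x} (hU.union hV)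
    (hAB.trans (union_subset_union hAU hBV))
  obtain ⟨s, hsf, hs, hsc⟩ := hf _ hev
  have himg : IsPreconnected ((fun t => v t x) '' s) :=
    hsc.image _ (v.continuous continuous_id continuous_const).continuousOn
  have hlim : omegaLimit f v {x} ⊆ closure ((fun t => v t x) '' s) := by
    simpa [image2_singleton_right] using omegaLimit_subset_closure_image2 f v {x} hsf
  have hsub : (fun t => v t x) '' s ⊆ U ∪ V := by
    rintro _ ⟨t, ht, rfl⟩
    exact hs ht (mem_singleton x)
  rcases himg.subset_or_subset hU hV hUV hsub with h | h
  · refine Or.inl fun y hy => (hAB hy).resolve_right fun hyB => ?_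
    exact (hUV.closure_left hV).le_bot ⟨closure_mono h (hlim hy), hBV hyB⟩
  · refine Or.inr fun y hy => (hAB hy).resolve_left fun hyA => ?_
    exact (hUV.closure_right hU).le_bot ⟨hAU hyA, closure_mono h (hlim hy)⟩

theorem isConnected_omegaLimit_atTop [T2Space X] [CompactSpace X] (x : X) :
    IsConnected (omegaLimit atTop v {x}) := by
  refine ⟨nonempty_omegaLimit _ _ _ (singleton_nonempty x), v.isPreconnected_omegaLimit ?_ x⟩
  intro u hu
  obtain ⟨a, ha⟩ := mem_atTop_sets.1 hu
  exact ⟨Ici a, Ici_mem_atTop a, ha, isPreconnected_Ici⟩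

theorem isConnected_omegaLimit_atBot [T2Space X] [CompactSpace X] (x : X) :
    IsConnected (omegaLimit atBot v {x}) := by
  refine ⟨nonempty_omegaLimit _ _ _ (singleton_nonempty x), v.isPreconnected_omegaLimit ?_ x⟩
  intro u hu
  obtain ⟨a, ha⟩ := mem_atBot_sets.1 hu
  exact ⟨Iic a, Iic_mem_atBot a, ha, isPreconnected_Iic⟩

theorem closure_orbit [T2Space X] (x : X) :
    closure (v.orbit x) = v.orbit x ∪ (omegaLimit atBot v {x} ∪ omegaLimit atTop v {x}) := by
  refine Subset.antisymm (fun y hy => ?_) (union_subset subset_closure (union_subset ?_ ?_))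
  · rw [orbit_eq_range, mem_closure_iff_clusterPt, ← map_top, ← mapClusterPt_def,
      mapClusterPt_iff_ultrafilter] at hy
    obtain ⟨u, -, hu⟩ := hy
    -- an ultrafilter on the line converges, or it escapes to one of the two ends
    by_cases hc : (u : Filter ℝ) ≤ cocompact ℝ
    · rw [cocompact_eq_atBot_atTop, Ultrafilter.le_sup_iff] at hc
      refine Or.inr (hc.imp (fun h => ?_) fun h => ?_) <;>
        exact (mem_omegaLimit_singleton_iff_mapClusterPt _ _ _ _).2
          (mapClusterPt_iff_ultrafilter.2 ⟨u, h, hu⟩)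
    · simp only [hasBasis_cocompact.ge_iff, not_forall] at hc
      obtain ⟨K, hK, hKu⟩ := hc
      obtain ⟨t, -, ht⟩ := isCompact_iff_ultrafilter_le_nhds'.1 hK u
        (Ultrafilter.compl_notMem_iff.1 hKu)
      have h : Tendsto (fun t => v t x) u (𝓝 (v t x)) :=
        ((v.continuous continuous_id continuous_const).tendsto t).mono_left ht
      exact Or.inl (tendsto_nhds_unique hu h ▸ v.mem_orbit x t)
  all_goals
    refine (omegaLimit_subset_closure_image2 _ v {x} univ_mem).trans (closure_mono ?_)
    rintro _ ⟨t, -, _, rfl, rfl⟩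
    exact v.mem_orbit _ t

end LimitSets

/-! ### Chains -/

section Chains

variable {X : Type*} [MetricSpace X] (v : Flow ℝ X)

/-- The chain relation of a flow: `y` can be reached from `x` by `(ε, T)`-chains for all positive
`ε` and `T`. -/
def ChainRelated (x y : X) : Prop :=
  ∀ ε > 0, ∀ T > 0, v.HasChain ε T x y

variable {v}

theorem ChainRelated.trans {x y z : X} (hxy : v.ChainRelated x y) (hyz : v.ChainRelated y z) :
    v.ChainRelated x z :=
  fun ε hε T hT => Relation.TransGen.trans (hxy ε hε T hT) (hyz ε hε T hT)

theorem hasChain_of_dist_lt {ε T t : ℝ} {x y : X} (ht : T ≤ t) (h : dist (v t x) y < ε) :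
    v.HasChain ε T x y :=
  Relation.TransGen.single ⟨t, ht, h⟩

theorem frequently_dist_lt_of_mem_omegaLimit {f : Filter ℝ} {x z : X}
    (hz : z ∈ omegaLimit f v {x}) {ε : ℝ} (hε : 0 < ε) : ∃ᶠ t in f, dist (v t x) z < ε :=
  ((mem_omegaLimit_singleton_iff_mapClusterPt _ _ _ _).1 hz).frequently (Metric.ball_mem_nhds z hε)

/-- A limit point `z` of the orbit of `x` is the start of chains that jump onto this orbit: when
`v t x` is near `z`, the point `v T z` is near `v (T + t) x`. -/
theorem frequently_hasChain_of_mem_omegaLimit {f : Filter ℝ} {x z : X}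
    (hz : z ∈ omegaLimit f v {x}) {ε : ℝ} (hε : 0 < ε) (T : ℝ) :
    ∃ᶠ t in f, v.HasChain ε T z (v (T + t) x) := by
  have hcont : Continuous fun y => v T y := v.continuous continuous_const continuous_id
  have hnhds : ∀ᶠ y in 𝓝 z, dist (v T z) (v T y) < ε := by
    have h : Tendsto (fun y => dist (v T z) (v T y)) (𝓝 z) (𝓝 (dist (v T z) (v T z))) :=
      (continuous_const.dist hcont).tendsto z
    rw [dist_self] at h
    exact h.eventually_lt_const hε
  refine (((mem_omegaLimit_singleton_iff_mapClusterPt _ _ _ _).1 hz).frequently hnhds).mono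
    fun t ht => hasChain_of_dist_lt le_rfl ?_
  rwa [v.map_add]

theorem chainRelated_of_mem_omegaLimit_atTop {x z : X} (hz : z ∈ omegaLimit atTop v {x}) :
    v.ChainRelated x z := by
  intro ε hε T _
  obtain ⟨t, ht, hTt⟩ :=
    ((frequently_dist_lt_of_mem_omegaLimit hz hε).and_eventually (eventually_ge_atTop T)).exists
  exact hasChain_of_dist_lt hTt ht

theorem chainRelated_of_mem_omegaLimit_atBot {x z : X} (hz : z ∈ omegaLimit atBot v {x}) :
    v.ChainRelated z x := by
  intro ε hε T _
  obtain ⟨t, ht, hTt⟩ := ((frequently_hasChain_of_mem_omegaLimit hz hε T).and_eventually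
    (eventually_le_atBot (-T - T))).exists
  refine Relation.TransGen.trans ht
    (hasChain_of_dist_lt (t := -(T + t)) (by linarith) ?_)
  rwa [← v.map_add, neg_add_cancel, v.map_zero_apply, dist_self]

/-! ### The chain recurrent set -/

variable (v)

theorem omegaLimit_atTop_subset_chainRecurrentSet (x : X) :
    omegaLimit atTop v {x} ⊆ v.chainRecurrentSet := by
  intro z hz ε hε T _
  obtain ⟨t, ht⟩ := (frequently_hasChain_of_mem_omegaLimit hz hε T).exists
  obtain ⟨s, hs, hts⟩ := ((frequently_dist_lt_of_mem_omegaLimit hz hε).and_eventually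
    (eventually_ge_atTop (T + (T + t)))).exists
  refine Relation.TransGen.trans ht
    (hasChain_of_dist_lt (t := s - (T + t)) (by linarith) ?_)
  rwa [← v.map_add, sub_add_cancel]

theorem omegaLimit_atBot_subset_chainRecurrentSet (x : X) :
    omegaLimit atBot v {x} ⊆ v.chainRecurrentSet := by
  intro z hz ε hε T _
  obtain ⟨s, hs⟩ := (frequently_dist_lt_of_mem_omegaLimit hz hε).exists
  obtain ⟨t, ht, hts⟩ := ((frequently_hasChain_of_mem_omegaLimit hz hε T).and_eventually
    (eventually_le_atBot (s - T - T))).exists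
  refine Relation.TransGen.trans ht
    (hasChain_of_dist_lt (t := s - (T + t)) (by linarith) ?_)
  rwa [← v.map_add, sub_add_cancel]

/-- The time-`s` map is uniformly continuous on a compact space, so it maps fine chains to
`(ε, T)`-chains. -/
theorem isInvariant_chainRecurrentSet [CompactSpace X] : IsInvariant v v.chainRecurrentSet := by
  intro s x hx ε hε T hT
  have hcont : Continuous fun y => v s y := v.continuous continuous_const continuous_id
  obtain ⟨δ, hδ, h⟩ := Metric.uniformContinuous_iff.1
    (CompactSpace.uniformContinuous_of_continuous hcont) ε hε
  refine Relation.TransGen.lift (fun y => v s y) ?_ _ _ (hx δ hδ T hT)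
  rintro a b ⟨t, ht, hab⟩
  refine ⟨t, ht, ?_⟩
  rw [← v.map_add, add_comm, v.map_add]
  exact h hab

theorem disjoint_orbit_chainRecurrentSet [CompactSpace X] {x : X}
    (hx : x ∉ v.chainRecurrentSet) : Disjoint (v.orbit x) v.chainRecurrentSet := by
  refine disjoint_left.2 fun y hy hyR => hx ?_
  obtain ⟨t, rfl⟩ := v.mem_orbit_iff.1 hy
  have h := v.isInvariant_chainRecurrentSet (-t) hyR
  rwa [← v.map_add, neg_add_cancel, v.map_zero_apply] at h

theorem derivedElem_orbitDecomposition [CompactSpace X] {x : X} (hx : x ∉ v.chainRecurrentSet) :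
    v.orbitDecomposition.derivedElem x = omegaLimit atBot v {x} ∪ omegaLimit atTop v {x} := by
  rw [SemiDecomposition.derivedElem, orbitDecomposition_elem, closure_orbit, union_sdiff_left]
  exact ((v.disjoint_orbit_chainRecurrentSet hx).mono_right
    (union_subset (v.omegaLimit_atBot_subset_chainRecurrentSet x)
      (v.omegaLimit_atTop_subset_chainRecurrentSet x))).sdiff_eq_right

/-- A connected set of chain recurrent points is chain transitive. -/
theorem chainRelated_of_isPreconnected {M : Set X} (hM : IsPreconnected M)
    (hMR : M ⊆ v.chainRecurrentSet) {a b : X} (ha : a ∈ M) (hb : b ∈ M) :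
    v.ChainRelated a b := by
  intro ε hε T hT
  refine hM.induction₂' (fun p q => v.HasChain ε T p q) (fun z hz => ?_)
    (fun _ _ _ _ _ _ h₁ h₂ => Relation.TransGen.trans h₁ h₂) ha hb
  have hloop := hMR hz ε hε T hT
  obtain ⟨c, ⟨t, ht, hzc⟩, hcz⟩ := Relation.TransGen.head'_iff.1 hloop
  obtain ⟨d, hzd, ⟨s, hs, hdz⟩⟩ := Relation.TransGen.tail'_iff.1 hloop
  -- the first and the last jump of a chain from `z` to `z` tolerate small changes of `z`
  have hcont : Continuous fun y => v t y := v.continuous continuous_const continuous_id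
  have hlast : ∀ᶠ y in 𝓝 z, dist (v s d) y < ε :=
    ((continuous_const.dist continuous_id).tendsto z).eventually_lt_const hdz
  have hfirst : ∀ᶠ y in 𝓝 z, dist (v t y) c < ε :=
    ((hcont.dist continuous_const).tendsto z).eventually_lt_const hzc
  filter_upwards [nhdsWithin_le_nhds hlast, nhdsWithin_le_nhds hfirst] with y hy hy'
  exact ⟨Relation.TransGen.tail' hzd ⟨s, hs, hy⟩, Relation.TransGen.head' ⟨t, ht, hy'⟩ hcz⟩

/-! ### The Morse graph -/

theorem pairwiseDisjoint_chainComponents : v.chainComponents.PairwiseDisjoint id := by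
  rintro _ ⟨a, -, rfl⟩ _ ⟨b, -, rfl⟩ hab
  refine disjoint_left.2 fun y hya hyb => hab ?_
  rw [connectedComponentIn_eq hya, connectedComponentIn_eq hyb]

theorem sUnion_chainComponents : ⋃₀ v.chainComponents = v.chainRecurrentSet := by
  refine Subset.antisymm (sUnion_subset ?_) fun x hx =>
    ⟨_, ⟨x, hx, rfl⟩, mem_connectedComponentIn hx⟩
  rintro _ ⟨x, -, rfl⟩
  exact connectedComponentIn_subset _ x

theorem exists_mem_chainComponents_superset {s : Set X} (hs : IsConnected s)
    (hsR : s ⊆ v.chainRecurrentSet) : ∃ M ∈ v.chainComponents, s ⊆ M := by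
  obtain ⟨x, hx⟩ := hs.nonempty
  exact ⟨_, ⟨x, hsR hx, rfl⟩, hs.isPreconnected.subset_connectedComponentIn hx hsR⟩

variable {v}

theorem chainRelated_of_mem_chainComponents {M : Set X} (hM : M ∈ v.chainComponents) {a b : X}
    (ha : a ∈ M) (hb : b ∈ M) : v.ChainRelated a b := by
  obtain ⟨x, -, rfl⟩ := hM
  exact v.chainRelated_of_isPreconnected isPreconnected_connectedComponentIn
    (connectedComponentIn_subset _ x) ha hb

variable [CompactSpace X]

/-- A point whose `α`-limit set lies in `M` can be reached by chains from all of `M`. -/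
theorem chainRelated_of_omegaLimit_atBot_subset {M : Set X} (hM : M ∈ v.chainComponents) {a x : X}
    (hx : omegaLimit atBot v {x} ⊆ M) (ha : a ∈ M) : v.ChainRelated a x := by
  obtain ⟨z, hz⟩ := (v.isConnected_omegaLimit_atBot x).nonempty
  exact (chainRelated_of_mem_chainComponents hM ha (hx hz)).trans
    (chainRelated_of_mem_omegaLimit_atBot hz)

/-- A point whose `ω`-limit set lies in `N` reaches all of `N` by chains. -/
theorem chainRelated_of_omegaLimit_atTop_subset {N : Set X} (hN : N ∈ v.chainComponents) {b x : X}
    (hx : omegaLimit atTop v {x} ⊆ N) (hb : b ∈ N) : v.ChainRelated x b := by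
  obtain ⟨z, hz⟩ := (v.isConnected_omegaLimit_atTop x).nonempty
  exact (chainRelated_of_mem_omegaLimit_atTop hz).trans
    (chainRelated_of_mem_chainComponents hN (hx hz) hb)

theorem ne_of_morseGraph_adj {M N : v.chainComponents} (h : v.morseGraph.Adj M N) : M ≠ N := by
  rintro rfl
  obtain ⟨x, hx, hα, hω⟩ := h
  obtain ⟨z, hz⟩ := (v.isConnected_omegaLimit_atTop x).nonempty
  exact hx ((chainRelated_of_omegaLimit_atTop_subset M.2 hω (hω hz)).trans
    (chainRelated_of_omegaLimit_atBot_subset M.2 hα (hω hz)))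

theorem not_morseGraph_adj_symm {M N : v.chainComponents} (h : v.morseGraph.Adj M N) :
    ¬ v.morseGraph.Adj N M := by
  rintro ⟨y, -, hαy, hωy⟩
  obtain ⟨x, hx, hαx, hωx⟩ := h
  obtain ⟨a, ha⟩ := (v.isConnected_omegaLimit_atBot x).nonempty
  obtain ⟨b, hb⟩ := (v.isConnected_omegaLimit_atTop x).nonempty
  have hxb : v.ChainRelated x b := chainRelated_of_omegaLimit_atTop_subset N.2 hωx (hωx hb)
  have hby : v.ChainRelated b y := chainRelated_of_omegaLimit_atBot_subset N.2 hαy (hωx hb)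
  have hya : v.ChainRelated y a := chainRelated_of_omegaLimit_atTop_subset M.2 hωy (hαx ha)
  have hax : v.ChainRelated a x := chainRelated_of_omegaLimit_atBot_subset M.2 hαx (hαx ha)
  exact hx (((hxb.trans hby).trans hya).trans hax)

theorem exists_omegaLimit_subset_chainComponents (v : Flow ℝ X) (x : X) :
    ∃ M N : v.chainComponents,
      omegaLimit atBot v {x} ⊆ (M : Set X) ∧ omegaLimit atTop v {x} ⊆ (N : Set X) := by
  obtain ⟨M, hM, hα⟩ := v.exists_mem_chainComponents_superset (v.isConnected_omegaLimit_atBot x)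
    (v.omegaLimit_atBot_subset_chainRecurrentSet x)
  obtain ⟨N, hN, hω⟩ := v.exists_mem_chainComponents_superset (v.isConnected_omegaLimit_atTop x)
    (v.omegaLimit_atTop_subset_chainRecurrentSet x)
  exact ⟨⟨M, hM⟩, ⟨N, hN⟩, hα, hω⟩

/-- A point outside the chain recurrent set whose limit sets lie in the components `M` and `N`
lies in `H_I` for `I = {M, N}` only. -/
theorem mem_hyperEdge_iff_eq_pair {x : X} (hx : x ∉ v.chainRecurrentSet)
    {M N : v.chainComponents} (hα : omegaLimit atBot v {x} ⊆ (M : Set X))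
    (hω : omegaLimit atTop v {x} ⊆ (N : Set X)) {I : Set (Set X)} (hI : I ⊆ v.chainComponents) :
    x ∈ v.orbitDecomposition.hyperEdge v.chainComponents I ↔ I = {(M : Set X), (N : Set X)} := by
  rw [SemiDecomposition.mem_hyperEdge_iff _ v.pairwiseDisjoint_chainComponents hI,
    v.derivedElem_orbitDecomposition hx, sUnion_chainComponents]
  have hsub := union_subset (v.omegaLimit_atBot_subset_chainRecurrentSet x)
    (v.omegaLimit_atTop_subset_chainRecurrentSet x)
  have hpair : {i ∈ v.chainComponents |
      ((omegaLimit atBot v {x} ∪ omegaLimit atTop v {x}) ∩ i).Nonempty} =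
        {(M : Set X), (N : Set X)} := by
    refine Subset.antisymm ?_ ?_
    · rintro i ⟨hi, y, hy | hy, hyi⟩
      · exact Or.inl (v.pairwiseDisjoint_chainComponents.elim_set hi M.2 y hyi (hα hy))
      · exact Or.inr (v.pairwiseDisjoint_chainComponents.elim_set hi N.2 y hyi (hω hy))
    · rintro _ (rfl | rfl)
      · obtain ⟨z, hz⟩ := (v.isConnected_omegaLimit_atBot x).nonempty
        exact ⟨M.2, z, Or.inl hz, hα hz⟩
      · obtain ⟨z, hz⟩ := (v.isConnected_omegaLimit_atTop x).nonempty
        exact ⟨N.2, z, Or.inr hz, hω hz⟩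
  rw [hpair]
  exact ⟨fun h => h.2.2, fun h => ⟨hx, hsub, h⟩⟩

theorem morseHypergraph_eq_toUndirected (v : Flow ℝ X) :
    v.orbitDecomposition.morseHypergraph v.chainComponents = v.morseGraph.toUndirected := by
  refine Hypergraph.ext rfl (Subset.antisymm ?_ ?_)
  · rintro I ⟨hI, x, hxI⟩
    have hx : x ∉ v.chainRecurrentSet := v.sUnion_chainComponents ▸ hxI.1
    obtain ⟨M, N, hα, hω⟩ := v.exists_omegaLimit_subset_chainComponents x
    exact ⟨M, N, ⟨x, hx, hα, hω⟩, (mem_hyperEdge_iff_eq_pair hx hα hω hI).1 hxI⟩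
  · rintro _ ⟨M, N, ⟨x, hx, hα, hω⟩, rfl⟩
    have hI : {(M : Set X), (N : Set X)} ⊆ v.chainComponents := pair_subset M.2 N.2
    exact ⟨hI, x, (mem_hyperEdge_iff_eq_pair hx hα hω hI).2 rfl⟩

theorem isMorseHypergraph_orbitDecomposition (v : Flow ℝ X) :
    v.orbitDecomposition.IsMorseHypergraph v.chainComponents where
  pairwiseDisjoint := v.pairwiseDisjoint_chainComponents
  edge_finite e he := by
    rw [v.morseHypergraph_eq_toUndirected] at he
    obtain ⟨M, N, -, rfl⟩ := he
    exact ⟨toFinite _, insert_nonempty _ _⟩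
  compl_eq := by
    refine Subset.antisymm (fun x hx => ?_) (iUnion₂_subset fun I _ x hx => hx.1)
    rw [sUnion_chainComponents] at hx
    obtain ⟨M, N, hα, hω⟩ := v.exists_omegaLimit_subset_chainComponents x
    have hI : {(M : Set X), (N : Set X)} ⊆ v.chainComponents := pair_subset M.2 N.2
    exact mem_biUnion hI ((mem_hyperEdge_iff_eq_pair hx hα hω hI).2 rfl)
  hyperEdge_disjoint I hI J hJ hIJ := by
    refine disjoint_left.2 fun x hxI hxJ => hIJ ?_
    have h := v.pairwiseDisjoint_chainComponents
    rw [((SemiDecomposition.mem_hyperEdge_iff _ h hI).1 hxI).2.2,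
      ((SemiDecomposition.mem_hyperEdge_iff _ h hJ).1 hxJ).2.2]

end Chains

end Flow

theorem mainTheorem6 {X : Type*} [MetricSpace X] [CompactSpace X] (v : Flow ℝ X) :
    v.orbitDecomposition.IsMorseHypergraph v.chainComponents ∧
    v.orbitDecomposition.morseHypergraph v.chainComponents = v.morseGraph.toUndirected ∧
    ∀ M N : v.chainComponents, v.morseGraph.Adj M N → M ≠ N ∧ ¬ v.morseGraph.Adj N M :=
  ⟨v.isMorseHypergraph_orbitDecomposition, v.morseHypergraph_eq_toUndirected,
    fun _ _ h => ⟨Flow.ne_of_morseGraph_adj h, Flow.not_morseGraph_adj_symm h⟩⟩
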